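/- Let $(X,d)$ be a metric space and let $\mathfrak{B}$ be a bornology on $X$, i.e. a family of subsets of $X$ that covers $X$, is hereditary (closed under passing to subsets) and is closed under finite unions. Assume $X\notin\mathfrak{B}$ (so $X$ is infinite) and that $\mathfrak{B}$ has a closed base, i.e. each $B\in\mathfrak{B}$ is contained in some closed set belonging to $\mathfrak{B}$. For $B\subseteq X$ and $\delta>0$ put $B^\delta=\bigcup_{x\in B}\{y\in X: d(x,y)<\delta\}$. A $\mathfrak{B}^s$-cover is a cover $\mathcal{U}$ of $X$ such that $X\notin\mathcal{U}$ and for each $B\in\mathfrak{B}$ there are $U\in\mathcal{U}$ and $\delta>0$ with $B^\delta\subseteq U$; it is open if all its members are open. Let $\mathcal{O}_{\mathfrak{B}^s}$ be the collection of all open $\mathfrak{B}^s$-covers. Let $\Gamma_{\mathfrak{B}^s}$ be the collection of all infinite open covers $\mathcal{U}$ of $X$ that can be enumerated as $\{U_n:n\in\mathbb{N}\}$ so that for every $B\in\mathfrak{B}$ there are $n_0$ and positive reals $\delta_n$ ($n\ge n_0$) with $B^{\delta_n}\subseteq U_n$ for all $n\ge n_0$. The space $X$ is $\mathfrak{B}^s$-Lindelöf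 if each $\mathfrak{B}^s$-cover contains a countable $\mathfrak{B}^s$-cover. For collections $\mathcal{A}$ and $\mathcal{C}$ of families of sets: - $S_1(\mathcal{A},\mathcal{C})$ means that for each sequence $(\mathcal{A}_n)_{n\in\mathbb{N}}$ in $\mathcal{A}$ there are $b_n\in \mathcal{A}_n$ with $\{b_n:n\in\mathbb{N}\}\in\mathcal{C}$; - $G_1(\mathcal{A},\mathcal{C})$ is the game in which, in the $n$-th round ($n\in\mathbb{N}$), ONE chooses $\mathcal{A}_n\in\mathcal{A}$ and TWO answers with some $b_n\in \mathcal{A}_n$; TWO wins if $\{b_n:n\in\mathbb{N}\}\in\mathcal{C}$, and otherwise ONE wins; - $\mathcal{A}\to(\mathcal{C})^n_k$ means that for each $\mathcal{U}\in\mathcal{A}$ and each function $f:[\mathcal{U}]^n\to\{1,\dots,k\}$ on the $n$-element subsets of $\mathcal{U}$ there are $i\in\{1,\dots,k\}$ and $\mathcal{V}\in\mathcal{C}$ with $\mathcal{V}\subseteq\mathcal{U}$ such that $f(s)=i$ for every $n$-element subset $s$ of $\mathcal{V}$. **Theorem.** The following are equivalent: 1. $S_1(\mathcal{O}_{\mathfrak{B}^s},\Gamma_{\mathfrak{B}^s})$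 holds; 2. ONE has no winning strategy in $G_1(\mathcal{O}_{\mathfrak{B}^s},\Gamma_{\mathfrak{B}^s})$. If moreover $X$ is $\mathfrak{B}^s$-Lindelöf, then they are also equivalent to 3. $\mathcal{O}_{\mathfrak{B}^s}\to(\Gamma_{\mathfrak{B}^s})^n_k$ holds for all integers $n,k\ge 1$. -/

import Mathlib

open Set

namespace BornologicalCovers

section Selection

variable {α : Type*}

/-- The selection principle `S₁(𝒜, ℬ)`: for each sequence `(A n)` of elements of `𝒜` one can
select `b n ∈ A n` such that the set `{b n : n}` belongs to `ℬ`. -/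
def SelectionOne (𝒜 ℬ : Set (Set α)) : Prop :=
  ∀ A : ℕ → Set α, (∀ n, A n ∈ 𝒜) → ∃ b : ℕ → α, (∀ n, b n ∈ A n) ∧ range b ∈ ℬ

/-- A strategy for ONE in the game `G₁(𝒜, ℬ)`: to each finite sequence of previous moves of TWO
(listed in the order in which they were made) it assigns an element of `𝒜`, ONE's next move. -/
def IsStrategyOne (𝒜 : Set (Set α)) (σ : List α → Set α) : Prop :=
  ∀ s : List α, σ s ∈ 𝒜

/-- The sequence `b` of moves of TWO is a legal play against the strategy `σ` of ONE: in each
round `n`, TWO picks an element of the set played by `σ` after `b 0, …, b (n - 1)`. -/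
def IsPlayAgainst (σ : List α → Set α) (b : ℕ → α) : Prop :=
  ∀ n : ℕ, b n ∈ σ (List.ofFn fun i : Fin n => b i)

/-- ONE has a winning strategy in the game `G₁(𝒜, ℬ)`; TWO wins a play in which the moves of TWO
are `b 0, b 1, …` if and only if the set `{b n : n}` belongs to `ℬ`. -/
def OneHasWinningStrategy (𝒜 ℬ : Set (Set α)) : Prop :=
  ∃ σ : List α → Set α, IsStrategyOne 𝒜 σ ∧
    ∀ b : ℕ → α, IsPlayAgainst σ b → range b ∉ ℬ

/-- `[U]ⁿ`, the collection of all `n`-element subsets of `U`. -/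
def nSubsets (U : Set α) (n : ℕ) : Set (Finset α) :=
  {s | (s : Set α) ⊆ U ∧ s.card = n}

/-- The ordinary partition relation `𝒜 → (ℬ)ⁿₖ`: for each `U ∈ 𝒜` and each colouring
`f : [U]ⁿ → {1, …, k}` there are a colour `i` and some `V ∈ ℬ`, `V ⊆ U`, such that `f` has the
constant value `i` on `[V]ⁿ`. -/
def PartitionRelation (𝒜 ℬ : Set (Set α)) (n k : ℕ) : Prop :=
  ∀ U ∈ 𝒜, ∀ f : nSubsets U n → Fin k,
    ∃ i : Fin k, ∃ V ∈ ℬ, V ⊆ U ∧ ∀ s : nSubsets U n, (s.1 : Set α) ⊆ V → f s = i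

end Selection

section Covers

variable {X : Type*} [MetricSpace X]

/-- The bornology `𝔅` (a bornology in its own right, unrelated to the metrically bounded sets)
has a base consisting of closed sets. -/
def HasClosedBase (𝔅 : Bornology X) : Prop :=
  ∃ 𝔅₀ : Set (Set X),
    (∀ B ∈ 𝔅₀, @Bornology.IsBounded X 𝔅 B ∧ IsClosed B) ∧
    ∀ B : Set X, @Bornology.IsBounded X 𝔅 B → ∃ B₀ ∈ 𝔅₀, B ⊆ B₀

/-- Strong `𝔅`-covers of `X` (`𝔅ˢ`-covers); `Metric.thickening δ B` is the union of the open balls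
of radius `δ` centred at the points of `B`. -/
def IsStrongCover (𝔅 : Bornology X) (U : Set (Set X)) : Prop :=
  ⋃₀ U = univ ∧ univ ∉ U ∧
    ∀ B : Set X, @Bornology.IsBounded X 𝔅 B →
      ∃ V ∈ U, ∃ δ : ℝ, 0 < δ ∧ Metric.thickening δ B ⊆ V

/-- The collection of all open `𝔅ˢ`-covers of `X`. -/
def openStrongCovers (𝔅 : Bornology X) : Set (Set (Set X)) :=
  {U | IsStrongCover 𝔅 U ∧ ∀ V ∈ U, IsOpen V}

/-- The collection of all `γ_{𝔅ˢ}`-covers of `X`. -/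
def gammaCovers (𝔅 : Bornology X) : Set (Set (Set X)) :=
  {U | ⋃₀ U = univ ∧ (∀ V ∈ U, IsOpen V) ∧ U.Infinite ∧
    ∃ u : ℕ → Set X, range u = U ∧
      ∀ B : Set X, @Bornology.IsBounded X 𝔅 B →
        ∃ (n₀ : ℕ) (δ : ℕ → ℝ), ∀ n ≥ n₀, 0 < δ n ∧ Metric.thickening (δ n) B ⊆ u n}

/-- `X` is `𝔅ˢ`-Lindelöf: each `𝔅ˢ`-cover contains a countable `𝔅ˢ`-cover. -/
def IsStrongLindelof (𝔅 : Bornology X) : Prop :=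
  ∀ U : Set (Set X), IsStrongCover 𝔅 U → ∃ V ⊆ U, V.Countable ∧ IsStrongCover 𝔅 V

end Covers

end BornologicalCovers

/-! A `γ`-cover is a countably infinite open family with each bounded set strongly inside all but
finitely many members, so its infinite subfamilies are again `γ`-covers (`gammaCovers_of_subset`).
Game: selection first thins ONE's moves to countable covers, leaving countably many positions; a
second selection answers all positions at once. Some play follows these answers, and it is infinite
because earlier moves are removed from each cover. Partitions: selecting from a constant sequence
yields a `γ`-subcover, and Ramsey's theorem thins it to a homogeneous one. Conversely, pairs in a
cover by sets `u n ∩ W`, with `W` in the common refinement of `A 0, …, A n`, are coloured by whether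
their indices agree. A homogeneous `γ`-cover cannot lie inside one `u n ≠ X`, so its indices are
distinct and unbounded, and its members can be enlarged to members of each `A n`. -/

namespace BornologicalCovers

section Ramsey

/-- The infinite Ramsey theorem for colourings of the `n`-element subsets of an infinite set. -/
theorem exists_infinite_homogeneous {α K : Type*} [Finite K] (n : ℕ) (c : Finset α → K)
    (S : Set α) (hS : S.Infinite) :
    ∃ H ⊆ S, H.Infinite ∧ ∃ i : K, ∀ s : Finset α, (s : Set α) ⊆ H → s.card = n → c s = i := by
  classical
  induction n generalizing c S with
  | zero =>
    refine ⟨S, Subset.rfl, hS, c ∅, fun s _ hs => ?_⟩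
    rw [Finset.card_eq_zero.1 hs]
  | succ n ih =>
    -- Fixing `a`, the induction hypothesis makes the colour of `insert a s` depend on `a` alone for
    -- `s` inside `R`.
    have step : ∀ T : {T : Set α // T.Infinite}, ∃ (a : α) (R : {R : Set α // R.Infinite}) (i : K),
        a ∈ T.1 ∧ R.1 ⊆ T.1 \ {a} ∧
          ∀ s : Finset α, (s : Set α) ⊆ R.1 → s.card = n → c (insert a s) = i := by
      rintro ⟨T, hT⟩
      obtain ⟨a, ha⟩ := hT.nonempty
      obtain ⟨R, hRT, hR, i, hi⟩ :=
        ih (fun s => c (insert a s)) (T \ {a}) (hT.sdiff (finite_singleton a))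
      exact ⟨a, ⟨R, hR⟩, i, ha, hRT, hi⟩
    choose a R i ha hR hi using step
    let T : ℕ → {T : Set α // T.Infinite} := fun m => R^[m] ⟨S, hS⟩
    have hT : ∀ m, T (m + 1) = R (T m) := fun m => Function.iterate_succ_apply' R m _
    have hanti : Antitone fun m => (T m).1 := antitone_nat_of_succ_le fun m => by
      change (T (m + 1)).1 ⊆ (T m).1
      rw [hT]
      exact (hR _).trans sdiff_subset
    have hlt : ∀ {m l}, m < l → a (T l) ∈ (R (T m)).1 := fun {m l} h =>
      hT m ▸ hanti (Nat.succ_le_of_lt h) (ha (T l))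
    have hne : ∀ {m l}, m < l → a (T l) ≠ a (T m) := fun h => (hR _ (hlt h)).2
    have hinj : Function.Injective fun m => a (T m) := by
      intro m l h
      rcases lt_trichotomy m l with h' | h' | h'
      · exact absurd h.symm (hne h')
      · exact h'
      · exact absurd h (hne h')
    -- A set of chosen points has the colour attached to its earliest point; pigeonhole makes these
    -- colours agree.
    obtain ⟨j, hj⟩ := Finite.exists_infinite_fiber fun m => i (T m)
    refine ⟨(fun m => a (T m)) '' {m | i (T m) = j}, ?_, ?_, j, ?_⟩
    · rintro _ ⟨m, -, rfl⟩
      exact hanti (Nat.zero_le m) (ha (T m))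
    · exact (Set.infinite_coe_iff.1 hj).image hinj.injOn
    · intro s hs hcard
      obtain ⟨t, ht, rfl⟩ := (Finset.subset_set_image_iff).1 hs
      rw [Finset.card_image_of_injective _ hinj] at hcard
      have htne : t.Nonempty := Finset.card_pos.1 (by omega)
      have hm := t.min'_mem htne
      rw [← Finset.insert_erase hm, Finset.image_insert, hi]
      · exact ht hm
      · intro x hx
        obtain ⟨l, hl, rfl⟩ := Finset.mem_image.1 (Finset.mem_coe.1 hx)
        exact hlt (Finset.min'_lt_of_mem_erase_min' _ htne hl)
      · rw [Finset.card_image_of_injective _ hinj, Finset.card_erase_of_mem hm, hcard]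
        rfl

end Ramsey

section Covers

variable {X : Type*} [MetricSpace X] {𝔅 : Bornology X}

/-! ### Strong inclusion and operations on covers -/

/-- Some positive thickening of `B` is contained in `V`. -/
def StronglyInside (B V : Set X) : Prop :=
  ∃ δ : ℝ, 0 < δ ∧ Metric.thickening δ B ⊆ V

theorem StronglyInside.subset {B V : Set X} (h : StronglyInside B V) : B ⊆ V := by
  obtain ⟨δ, hδ, h⟩ := h
  exact (Metric.self_subset_thickening hδ B).trans h

theorem StronglyInside.mono {B C V W : Set X} (h : StronglyInside C V) (hB : B ⊆ C)
    (hV : V ⊆ W) : StronglyInside B W := by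
  obtain ⟨δ, hδ, h⟩ := h
  exact ⟨δ, hδ, ((Metric.thickening_subset_of_subset δ hB).trans h).trans hV⟩

theorem StronglyInside.inter {B V W : Set X} (hV : StronglyInside B V)
    (hW : StronglyInside B W) : StronglyInside B (V ∩ W) := by
  obtain ⟨δ, hδ, hV⟩ := hV
  obtain ⟨ε, hε, hW⟩ := hW
  exact ⟨min δ ε, lt_min hδ hε, subset_inter
    ((Metric.thickening_mono (min_le_left _ _) B).trans hV)
    ((Metric.thickening_mono (min_le_right _ _) B).trans hW)⟩

/-- For an open strong cover the covering condition follows from the boundedness of points. -/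
theorem mem_openStrongCovers {U : Set (Set X)} :
    U ∈ openStrongCovers 𝔅 ↔ univ ∉ U ∧ (∀ V ∈ U, IsOpen V) ∧
      ∀ B : Set X, @Bornology.IsBounded X 𝔅 B → ∃ V ∈ U, StronglyInside B V := by
  refine ⟨fun h => ⟨h.1.2.1, h.2, h.1.2.2⟩, fun ⟨h₁, h₂, h₃⟩ => ⟨⟨?_, h₁, h₃⟩, h₂⟩⟩
  refine eq_univ_of_forall fun x => ?_
  obtain ⟨V, hV, hx⟩ := h₃ {x} (@Bornology.isBounded_singleton X 𝔅 x)
  exact ⟨V, hV, hx.subset rfl⟩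

/-- A `γ`-cover is a countably infinite family of open sets such that each bounded set is
strongly inside all but finitely many of its members. -/
theorem mem_gammaCovers {U : Set (Set X)} :
    U ∈ gammaCovers 𝔅 ↔ (∀ V ∈ U, IsOpen V) ∧ U.Infinite ∧ U.Countable ∧
      ∀ B : Set X, @Bornology.IsBounded X 𝔅 B → {V ∈ U | ¬ StronglyInside B V}.Finite := by
  constructor
  · rintro ⟨-, ho, hi, u, rfl, hu⟩
    refine ⟨ho, hi, countable_range u, fun B hB => ?_⟩
    obtain ⟨n₀, δ, h⟩ := hu B hB
    refine ((finite_lt_nat n₀).image u).subset ?_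
    rintro _ ⟨⟨n, rfl⟩, hn⟩
    refine ⟨n, ?_, rfl⟩
    by_contra hlt
    exact hn ⟨δ n, h n (not_lt.1 hlt)⟩
  · rintro ⟨ho, hi, hc, hfin⟩
    refine ⟨eq_univ_of_forall fun x => ?_, ho, hi, ?_⟩
    · obtain ⟨V, hV, hx⟩ :=
        (hi.sdiff (hfin {x} (@Bornology.isBounded_singleton X 𝔅 x))).nonempty
      exact ⟨V, hV, StronglyInside.subset (not_not.1 fun h => hx ⟨hV, h⟩) rfl⟩
    · have := hc.to_subtype
      have := hi.to_subtype
      obtain ⟨e⟩ : Nonempty (ℕ ≃ U) := nonempty_equiv_of_countable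
      refine ⟨fun n => e n, ?_, fun B hB => ?_⟩
      · rw [show (fun n => (e n : Set X)) = Subtype.val ∘ e from rfl, e.surjective.range_comp,
          Subtype.range_coe]
      · have hfin' : {n | ¬ StronglyInside B (e n : Set X)}.Finite :=
          ((hfin B hB).preimage (Subtype.val_injective.comp e.injective).injOn).subset
            fun n hn => ⟨(e n).2, hn⟩
        obtain ⟨N, hN⟩ := hfin'.bddAbove
        have h : ∀ n, ∃ δ : ℝ, N + 1 ≤ n → 0 < δ ∧ Metric.thickening δ B ⊆ (e n : Set X) := by
          intro n
          by_cases hn : StronglyInside B (e n : Set X)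
          · obtain ⟨δ, hδ⟩ := hn
            exact ⟨δ, fun _ => hδ⟩
          · exact ⟨0, fun hle => absurd (hN hn) (by omega)⟩
        choose δ hδ using h
        exact ⟨N + 1, δ, hδ⟩

theorem gammaCovers_of_subset {U V : Set (Set X)} (hU : U ∈ gammaCovers 𝔅) (hVU : V ⊆ U)
    (hV : V.Infinite) : V ∈ gammaCovers 𝔅 := by
  rw [mem_gammaCovers] at hU ⊢
  obtain ⟨ho, -, hc, hfin⟩ := hU
  exact ⟨fun W hW => ho W (hVU hW), hV, hc.mono hVU,
    fun B hB => (hfin B hB).subset fun W hW => ⟨hVU hW.1, hW.2⟩⟩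

theorem openStrongCovers_of_gammaCovers {U : Set (Set X)} (hU : U ∈ gammaCovers 𝔅)
    (hne : univ ∉ U) : U ∈ openStrongCovers 𝔅 := by
  rw [mem_gammaCovers] at hU
  obtain ⟨ho, hi, -, hfin⟩ := hU
  refine mem_openStrongCovers.2 ⟨hne, ho, fun B hB => ?_⟩
  obtain ⟨V, hV, h⟩ := (hi.sdiff (hfin B hB)).nonempty
  exact ⟨V, hV, not_not.1 fun h' => h ⟨hV, h'⟩⟩

/-- A sequence of proper open sets in which each bounded set is eventually strongly inside
enumerates a `γ`-cover. -/
theorem range_mem_gammaCovers {u : ℕ → Set X} (ho : ∀ n, IsOpen (u n)) (hne : ∀ n, u n ≠ univ)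
    (h : ∀ B : Set X, @Bornology.IsBounded X 𝔅 B → ∃ n₀, ∀ n ≥ n₀, StronglyInside B (u n)) :
    range u ∈ gammaCovers 𝔅 := by
  refine mem_gammaCovers.2 ⟨by rintro _ ⟨n, rfl⟩; exact ho n, fun hfin => ?_, countable_range u,
    fun B hB => ?_⟩
  · have := hfin.to_subtype
    -- With finite range, some proper set would recur infinitely often and so contain every point.
    obtain ⟨⟨V, hV⟩, hinf⟩ := Finite.exists_infinite_fiber (rangeFactorization u)
    rw [Set.infinite_coe_iff] at hinf
    obtain ⟨m, rfl⟩ := hV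
    refine hne m (eq_univ_of_forall fun x => ?_)
    obtain ⟨n₀, hn₀⟩ := h {x} (@Bornology.isBounded_singleton X 𝔅 x)
    obtain ⟨n, hn, hle⟩ := hinf.exists_gt n₀
    have hnm : u n = u m := congrArg Subtype.val hn
    exact hnm ▸ (hn₀ n hle.le).subset rfl
  · obtain ⟨n₀, hn₀⟩ := h B hB
    refine ((finite_lt_nat n₀).image u).subset ?_
    rintro _ ⟨⟨n, rfl⟩, hn⟩
    exact ⟨n, not_le.1 fun hle => hn (hn₀ n hle), rfl⟩

/-- Removing finitely many members from an open strong cover leaves an open strong cover. -/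
theorem sdiff_mem_openStrongCovers {U F : Set (Set X)} (hU : U ∈ openStrongCovers 𝔅)
    (hF : F.Finite) : U \ F ∈ openStrongCovers 𝔅 := by
  rw [mem_openStrongCovers] at hU ⊢
  obtain ⟨hne, ho, hc⟩ := hU
  refine ⟨fun h => hne h.1, fun V hV => ho V hV.1, fun B hB => ?_⟩
  -- Adding to `B` a point missed by each removed member forces the set found for the enlarged `B`
  -- to lie outside `F`.
  have hpt : ∀ V : Set X, ∃ C : Set X, C.Finite ∧ (V ∈ U → ¬ C ⊆ V) := by
    intro V
    by_cases hV : V = univ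
    · exact ⟨∅, finite_empty, fun h => absurd (hV ▸ h) hne⟩
    · obtain ⟨x, hx⟩ := (ne_univ_iff_exists_notMem V).1 hV
      exact ⟨{x}, finite_singleton x, fun _ h => hx (h rfl)⟩
  choose C hCfin hC using hpt
  have hbdd : @Bornology.IsBounded X 𝔅 (B ∪ ⋃ V ∈ F, C V) :=
    (@Bornology.isBounded_union X 𝔅 _ _).2
      ⟨hB, @Set.Finite.isBounded X 𝔅 _ (hF.biUnion fun V _ => hCfin V)⟩
  obtain ⟨V, hV, h⟩ := hc _ hbdd
  refine ⟨V, ⟨hV, fun hVF => hC V hV ?_⟩, h.mono subset_union_left Subset.rfl⟩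
  exact (subset_biUnion_of_mem (u := C) hVF).trans (subset_union_right.trans h.subset)

theorem inter_mem_openStrongCovers {ι : Type*} {U : ι → Set X} (hU : range U ∈ openStrongCovers 𝔅)
    {W : ι → Set (Set X)} (hW : ∀ i, W i ∈ openStrongCovers 𝔅) :
    {V | ∃ i, ∃ A ∈ W i, V = U i ∩ A} ∈ openStrongCovers 𝔅 := by
  rw [mem_openStrongCovers] at hU ⊢
  obtain ⟨hne, ho, hc⟩ := hU
  refine ⟨?_, ?_, fun B hB => ?_⟩
  · rintro ⟨i, A, -, h⟩
    exact hne ⟨i, univ_subset_iff.1 (h.le.trans inter_subset_left)⟩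
  · rintro _ ⟨i, A, hA, rfl⟩
    exact (ho _ ⟨i, rfl⟩).inter ((hW i).2 A hA)
  · obtain ⟨_, ⟨i, rfl⟩, hi⟩ := hc B hB
    obtain ⟨A, hA, hBA⟩ := (mem_openStrongCovers.1 (hW i)).2.2 B hB
    exact ⟨_, ⟨i, A, hA, rfl⟩, hi.inter hBA⟩

/-- The common refinement of the first `n + 1` covers of a sequence of covers. -/
def commonRefinement {α : Type*} (A : ℕ → Set (Set α)) : ℕ → Set (Set α)
  | 0 => A 0
  | n + 1 => {V | ∃ W : commonRefinement A n, ∃ C ∈ A (n + 1), V = W.1 ∩ C}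

theorem commonRefinement_mem_openStrongCovers {A : ℕ → Set (Set X)}
    (hA : ∀ n, A n ∈ openStrongCovers 𝔅) (n : ℕ) :
    commonRefinement A n ∈ openStrongCovers 𝔅 := by
  induction n with
  | zero => exact hA 0
  | succ n ih =>
    exact inter_mem_openStrongCovers (U := Subtype.val) (by rwa [Subtype.range_coe])
      fun _ => hA (n + 1)

theorem exists_superset_of_mem_commonRefinement {α : Type*} {A : ℕ → Set (Set α)} {m n : ℕ}
    (hmn : m ≤ n) :
    ∀ V ∈ commonRefinement A n, ∃ W ∈ A m, V ⊆ W := by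
  induction n with
  | zero =>
    obtain rfl := Nat.le_zero.1 hmn
    exact fun V hV => ⟨V, hV, Subset.rfl⟩
  | succ n ih =>
    rintro _ ⟨⟨V, hV⟩, C, hC, rfl⟩
    rcases Nat.le_succ_iff.1 hmn with h | rfl
    · obtain ⟨W, hW, hVW⟩ := ih h V hV
      exact ⟨W, hW, inter_subset_left.trans hVW⟩
    · exact ⟨C, hC, inter_subset_right⟩

/-! ### Selection and the game -/

/-- A sequence violating selection is a winning strategy that looks only at the round number. -/
theorem selectionOne_of_not_oneHasWinningStrategy {α : Type*} {𝒜 ℬ : Set (Set α)}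
    (h : ¬ OneHasWinningStrategy 𝒜 ℬ) : SelectionOne 𝒜 ℬ := by
  intro A hA
  by_contra hcon
  refine h ⟨fun s => A s.length, fun s => hA _, fun b hb hmem => hcon ⟨b, fun n => ?_, hmem⟩⟩
  simpa using hb n

/-- The position of the game reached when TWO picks, in each round, the member with the given
index in the enumeration `e`; indices are listed with the latest one first. -/
def position {α : Type*} (e : List α → ℕ → α) : List ℕ → List α
  | [] => []
  | n :: τ => position e τ ++ [e (position e τ) n]

theorem not_oneHasWinningStrategy_of_selectionOne
    (h : SelectionOne (openStrongCovers 𝔅) (gammaCovers 𝔅)) :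
    ¬ OneHasWinningStrategy (openStrongCovers 𝔅) (gammaCovers 𝔅) := by
  rintro ⟨σ, hσ, hwin⟩
  have hsub : ∀ s : List (Set X), ∃ e : ℕ → Set X, (∀ n, e n ∈ σ s \ {V | V ∈ s}) ∧
      range e ∈ openStrongCovers 𝔅 := by
    intro s
    have hmem := sdiff_mem_openStrongCovers (hσ s) s.finite_toSet
    obtain ⟨e, he, hΓ⟩ := h (fun _ => σ s \ {V | V ∈ s}) fun _ => hmem
    refine ⟨e, he, openStrongCovers_of_gammaCovers hΓ ?_⟩
    rintro ⟨n, hn⟩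
    exact (mem_openStrongCovers.1 hmem).1 (hn ▸ he n)
  choose e he heO using hsub
  let d : ℕ ≃ List ℕ := (Denumerable.eqv (List ℕ)).symm
  -- One selection over all coded positions; `g` below reads off the chosen index at each position.
  obtain ⟨c, hc, hΓ⟩ := h (fun m => range (e (position e (d m)))) fun m => heO _
  choose f hf using hc
  let g : List ℕ → ℕ := fun τ => f (d.symm τ)
  have hg : ∀ τ, e (position e τ) (g τ) ∈ range c := by
    intro τ
    refine ⟨d.symm τ, ?_⟩
    rw [← hf, d.apply_symm_apply]
  let τ : ℕ → List ℕ := fun n => (fun s => g s :: s)^[n] []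
  have hτ : ∀ n, τ (n + 1) = g (τ n) :: τ n := fun n => Function.iterate_succ_apply' _ n _
  let b : ℕ → Set X := fun n => e (position e (τ n)) (g (τ n))
  have hpos : ∀ n, position e (τ n) = List.ofFn fun i : Fin n => b i := by
    intro n
    induction n with
    | zero => rfl
    | succ n ih =>
      rw [hτ, position, List.ofFn_succ_last, ih]
      simp only [Fin.val_castSucc, Fin.val_last, ← ih]
      rfl
  have hb : ∀ n, b n ∈ σ (List.ofFn fun i : Fin n => b i) \
      {V | V ∈ List.ofFn fun i : Fin n => b i} := fun n => hpos n ▸ he _ _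
  have hne : ∀ {m n}, m < n → b m ≠ b n := fun {m n} hmn heq =>
    (hb n).2 ((List.mem_ofFn' _ _).2 ⟨⟨m, hmn⟩, heq⟩)
  have hinj : Function.Injective b := by
    intro m n hmn
    rcases lt_trichotomy m n with h' | h' | h'
    · exact absurd hmn (hne h')
    · exact h'
    · exact absurd hmn.symm (hne h')
  refine hwin b (fun n => (hb n).1) (gammaCovers_of_subset hΓ ?_ (infinite_range_of_injective hinj))
  rintro _ ⟨n, rfl⟩
  exact hg _

/-! ### Selection and the partition relation -/

theorem partitionRelation_of_selectionOne
    (h : SelectionOne (openStrongCovers 𝔅) (gammaCovers 𝔅)) (n k : ℕ) (hk : 1 ≤ k) :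
    PartitionRelation (openStrongCovers 𝔅) (gammaCovers 𝔅) n k := by
  classical
  intro U hU f
  obtain ⟨b, hb, hΓ⟩ := h (fun _ => U) fun _ => hU
  -- Finite sets outside `nSubsets U n` get a dummy colour, which exists since `1 ≤ k`.
  obtain ⟨H, hHb, hH, i, hi⟩ := exists_infinite_homogeneous n
    (fun s => if hs : s ∈ nSubsets U n then f ⟨s, hs⟩ else ⟨0, hk⟩) (range b)
    (mem_gammaCovers.1 hΓ).2.1
  refine ⟨i, H, gammaCovers_of_subset hΓ hHb hH, ?_, fun s hs => ?_⟩
  · exact hHb.trans (by rintro _ ⟨m, rfl⟩; exact hb m)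
  · simpa [s.2] using hi s.1 hs s.2.2

theorem selectionOne_of_partitionRelation (hL : IsStrongLindelof 𝔅)
    (h : PartitionRelation (openStrongCovers 𝔅) (gammaCovers 𝔅) 2 2) :
    SelectionOne (openStrongCovers 𝔅) (gammaCovers 𝔅) := by
  classical
  intro A hA
  have hR := commonRefinement_mem_openStrongCovers hA
  obtain ⟨C, hCA, hCc, hC⟩ := hL (A 0) (hA 0).1
  have hCO : C ∈ openStrongCovers 𝔅 := ⟨hC, fun V hV => (hA 0).2 V (hCA hV)⟩
  obtain ⟨V₀, hV₀, -⟩ := hC.2.2 ∅ (@Bornology.isBounded_empty X 𝔅)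
  obtain ⟨u, rfl⟩ := hCc.exists_eq_range ⟨V₀, hV₀⟩
  let U : Set (Set X) := {V | ∃ n, ∃ W ∈ commonRefinement A n, V = u n ∩ W}
  have hU : U ∈ openStrongCovers 𝔅 := inter_mem_openStrongCovers hCO hR
  -- A set may have several representations `u n ∩ W`; one is fixed so that its index `N` can define
  -- the colouring.
  have hrep : ∀ V : Set X, ∃ (n : ℕ) (W : Set X),
      V ∈ U → W ∈ commonRefinement A n ∧ V = u n ∩ W := by
    intro V
    by_cases hV : V ∈ U
    · obtain ⟨n, W, hW⟩ := hV
      exact ⟨n, W, fun _ => hW⟩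
    · exact ⟨0, ∅, fun h => absurd h hV⟩
  choose N W hW using hrep
  obtain ⟨i, H, hΓ, hHU, hi⟩ := h U hU fun s =>
    if ∃ x ∈ s.1, ∃ y ∈ s.1, N x ≠ N y then 1 else 0
  have hHΓ := mem_gammaCovers.1 hΓ
  have hpair : ∀ {x y}, x ∈ H → y ∈ H → x ≠ y → (if N x ≠ N y then (1 : Fin 2) else 0) = i := by
    intro x y hx hy hxy
    have hsub : (({x, y} : Finset (Set X)) : Set (Set X)) ⊆ H := by
      simp [insert_subset_iff, hx, hy]
    have := hi ⟨{x, y}, hsub.trans hHU, Finset.card_pair hxy⟩ hsub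
    rw [← this]
    by_cases hN : N x = N y
    · simp [hN]
    · simp [hN, Ne.symm hN, eq_comm]
  have hinj : InjOn N H := by
    intro x hx y hy hxy
    by_contra hne
    have hi0 : i = 0 := by rw [← hpair hx hy hne]; simp [hxy]
    have hconst : ∀ z ∈ H, N z = N x := by
      intro z hz
      by_cases hzx : z = x
      · rw [hzx]
      · by_contra hN
        have := hpair hz hx hzx
        simp [hN, hi0] at this
    refine hCO.1.2.1 ⟨N x, univ_subset_iff.1 ?_⟩
    rw [← hΓ.1]
    refine sUnion_subset fun z hz => ?_
    rw [(hW z (hHU hz)).2, hconst z hz]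
    exact inter_subset_left
  have hlarge : ∀ n, ∃ V ∈ H, n ≤ N V := by
    intro n
    obtain ⟨_, ⟨V, hV, rfl⟩, hlt⟩ := (hHΓ.2.1.image hinj).exists_gt n
    exact ⟨V, hV, hlt.le⟩
  choose V hVH hVN using hlarge
  have hsup : ∀ n, ∃ b ∈ A n, V n ⊆ b := by
    intro n
    have hV := hW (V n) (hHU (hVH n))
    obtain ⟨b, hb, hsub⟩ := exists_superset_of_mem_commonRefinement (hVN n) _ hV.1
    exact ⟨b, hb, hV.2.le.trans (inter_subset_right.trans hsub)⟩
  choose b hb hVb using hsup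
  refine ⟨b, hb, range_mem_gammaCovers (fun n => (hA n).2 _ (hb n))
    (fun n hn => (hA n).1.2.1 (hn ▸ hb n)) fun B hB => ?_⟩
  -- The finitely many exceptional members of `H` have indices at most `M`, while `V n` has index at
  -- least `n`.
  obtain ⟨M, hM⟩ := ((hHΓ.2.2.2 B hB).image N).bddAbove
  refine ⟨M + 1, fun n hn => ?_⟩
  refine StronglyInside.mono (not_not.1 fun hnot => ?_) Subset.rfl (hVb n)
  have h₁ : N (V n) ≤ M := hM ⟨V n, ⟨hVH n, hnot⟩, rfl⟩
  have h₂ := hVN n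
  omega

end Covers

end BornologicalCovers

theorem mainTheorem9 {X : Type*} [MetricSpace X] (𝔅 : Bornology X)
    (hX : ¬ @Bornology.IsBounded X 𝔅 Set.univ)
    (hB : BornologicalCovers.HasClosedBase 𝔅) :
    (BornologicalCovers.SelectionOne
        (BornologicalCovers.openStrongCovers 𝔅) (BornologicalCovers.gammaCovers 𝔅) ↔
      ¬ BornologicalCovers.OneHasWinningStrategy
        (BornologicalCovers.openStrongCovers 𝔅) (BornologicalCovers.gammaCovers 𝔅)) ∧
    (BornologicalCovers.IsStrongLindelof 𝔅 →
      (BornologicalCovers.SelectionOne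
          (BornologicalCovers.openStrongCovers 𝔅) (BornologicalCovers.gammaCovers 𝔅) ↔
        ∀ n k : ℕ, 1 ≤ n → 1 ≤ k →
          BornologicalCovers.PartitionRelation
            (BornologicalCovers.openStrongCovers 𝔅) (BornologicalCovers.gammaCovers 𝔅) n k)) := by
  exact ⟨⟨BornologicalCovers.not_oneHasWinningStrategy_of_selectionOne,
      BornologicalCovers.selectionOne_of_not_oneHasWinningStrategy⟩,
    fun hL => ⟨fun h n k _ hk => BornologicalCovers.partitionRelation_of_selectionOne h n k hk,
      fun h => BornologicalCovers.selectionOne_of_partitionRelation hL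
        (h 2 2 one_le_two one_le_two)⟩⟩
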